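/- Let $n\ge 0$ be an integer and let $\mathbb F_q$ be a finite field of characteristic different from $2$. Let $\mathfrak b$ be the algebra of upper triangular $n\times n$ matrices over $\mathbb F_q$, let $\mathfrak n\subset\mathfrak b$ be the subspace of strictly upper triangular matrices, and let $\mathfrak n^*$ be its dual space, on which $\mathfrak b$ acts by $(t\lambda)(x)=\lambda(xt)$ and $(\lambda t)(x)=\lambda(tx)$ for $t\in\mathfrak b$, $x\in\mathfrak n$, $\lambda\in\mathfrak n^*$. Let $\mathfrak g^a=\mathfrak b\oplus\mathfrak n^*$ be the associative algebra with multiplication $$(t_1+\lambda_1)(t_2+\lambda_2)=t_1t_2+t_1\lambda_2+\lambda_1t_2,$$ let $\mathfrak u=\mathfrak n+\mathfrak n^*\subset\mathfrak g^a$, and let $U^a=1+\mathfrak u$, a subgroup of the group of invertible elements of $\mathfrak g^a$. The superclass of $u=1+X\in U^a$ is the set $K(u)=1+U^aXU^a=\{1+aXb : a,b\in U^a\}$. Let $\Delta=\{(i,j): 1\le i,j\le n,\ i\ne j\}$ be the set of roots; $(i,j)$ is positive if $i<j$ and negative if $i>j$. For $i<j$ let $E_{ij}\in\mathfrak n$ be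 the matrix unit, and for $i>j$ let $F_{ij}\in\mathfrak n^*$ be the functional $F_{ij}(x)=x_{ji}$. A rook placement is a subset $D\subset\Delta$ that contains at most one root $(i,j)$ in each row $i$ and at most one in each column $j$. For a rook placement $D$ and a map $\phi:D\to\mathbb F_q^*$ put $$u_{D,\phi}=1+X_{D,\phi},\qquad X_{D,\phi}=\sum_{\substack{(i,j)\in D\\ i<j}}\phi(i,j)E_{ij}+\sum_{\substack{(i,j)\in D\\ i>j}}\phi(i,j)F_{ij}.$$ Then: 1. Each superclass of $U^a$ contains an element $u_{D,\phi}$ for some rook placement $D\subset\Delta$ and some map $\phi:D\to\mathbb F_q^*$. 2. Two elements $u_{D,\phi}$ and $u_{D',\phi'}$ (where $D,D'$ are rook placements, $\phi:D\to\mathbb F_q^*$ and $\phi':D'\to\mathbb F_q^*$) belong to a common superclass if and only if $(D,\phi)=(D',\phi')$. -/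

import Mathlib

namespace BorelContraction

/-- The associative algebra `𝔟` of upper triangular `n × n` matrices over `K`. -/
abbrev borel (n : ℕ) (K : Type*) [Field K] : Subalgebra K (Matrix (Fin n) (Fin n) K) :=
  Matrix.blockTriangularSubalgebra K K (id : Fin n → Fin n)

/-- The space `𝔫` of strictly upper triangular `n × n` matrices over `K`. -/
def nil (n : ℕ) (K : Type*) [Field K] : Submodule K (Matrix (Fin n) (Fin n) K) where
  carrier := {x | ∀ i j, j ≤ i → x i j = 0}
  zero_mem' := fun _ _ _ => rfl
  add_mem' := fun {a b} ha hb i j h => by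
    rw [Matrix.add_apply, ha i j h, hb i j h, add_zero]
  smul_mem' := fun c x hx i j h => by
    rw [Matrix.smul_apply, hx i j h, smul_zero]

section

variable {n : ℕ} {K : Type*} [Field K]

theorem mul_mem_nil_left {t x : Matrix (Fin n) (Fin n) K} (ht : t ∈ borel n K)
    (hx : x ∈ nil n K) : t * x ∈ nil n K := by
  intro i j hij
  rw [Matrix.mul_apply]
  refine Finset.sum_eq_zero fun k _ => ?_
  rcases lt_or_ge k i with h | h
  · rw [show t i k = 0 from ht h, zero_mul]
  · rw [hx k j (hij.trans h), mul_zero]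

theorem mul_mem_nil_right {t x : Matrix (Fin n) (Fin n) K} (ht : t ∈ borel n K)
    (hx : x ∈ nil n K) : x * t ∈ nil n K := by
  intro i j hij
  rw [Matrix.mul_apply]
  refine Finset.sum_eq_zero fun k _ => ?_
  rcases lt_or_ge j k with h | h
  · rw [show t k j = 0 from ht h, mul_zero]
  · rw [hx i k (h.trans hij), zero_mul]

/-- Left multiplication `x ↦ t x` on `𝔫` by `t ∈ 𝔟`. -/
def mulLeft (t : borel n K) : nil n K →ₗ[K] nil n K where
  toFun x := ⟨t * x, mul_mem_nil_left t.2 x.2⟩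
  map_add' _ _ := Subtype.ext (mul_add _ _ _)
  map_smul' _ _ := Subtype.ext (mul_smul_comm _ _ _)

/-- Right multiplication `x ↦ x t` on `𝔫` by `t ∈ 𝔟`. -/
def mulRight (t : borel n K) : nil n K →ₗ[K] nil n K where
  toFun x := ⟨x * t, mul_mem_nil_right t.2 x.2⟩
  map_add' _ _ := Subtype.ext (add_mul _ _ _)
  map_smul' _ _ := Subtype.ext (smul_mul_assoc _ _ _)

end

/-- The dual space `𝔫*`. -/
abbrev NilDual (n : ℕ) (K : Type*) [Field K] : Type _ := Module.Dual K (nil n K)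

section

variable {n : ℕ} {K : Type*} [Field K]

/-- The left action of `𝔟` on `𝔫*`: `(t λ)(x) = λ(x t)`. -/
instance leftModule : Module (borel n K) (NilDual n K) where
  smul t l := l ∘ₗ mulRight t
  one_smul l := LinearMap.ext fun _ => congrArg l (Subtype.ext (mul_one _))
  mul_smul _ _ l := LinearMap.ext fun _ => congrArg l (Subtype.ext (mul_assoc _ _ _).symm)
  smul_zero _ := rfl
  smul_add _ _ _ := rfl
  add_smul s t l := LinearMap.ext fun x =>
    (congrArg l (Subtype.ext (mul_add _ _ _) : mulRight (s + t) x = mulRight s x + mulRight t x)).trans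
      (map_add l _ _)
  zero_smul l := LinearMap.ext fun x =>
    (congrArg l (Subtype.ext (mul_zero _) : mulRight 0 x = 0)).trans (map_zero l)

/-- The right action of `𝔟` on `𝔫*`: `(λ t)(x) = λ(t x)`. -/
instance rightModule : Module (borel n K)ᵐᵒᵖ (NilDual n K) where
  smul t l := l ∘ₗ mulLeft t.unop
  one_smul l := LinearMap.ext fun _ => congrArg l (Subtype.ext (one_mul _))
  mul_smul _ _ l := LinearMap.ext fun _ => congrArg l (Subtype.ext (mul_assoc _ _ _))
  smul_zero _ := rfl
  smul_add _ _ _ := rfl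
  add_smul s t l := LinearMap.ext fun x =>
    (congrArg l (Subtype.ext (add_mul _ _ _) :
      mulLeft (s + t).unop x = mulLeft s.unop x + mulLeft t.unop x)).trans (map_add l _ _)
  zero_smul l := LinearMap.ext fun x =>
    (congrArg l (Subtype.ext (zero_mul _) : mulLeft 0 x = 0)).trans (map_zero l)

theorem smul_dual_apply (t : borel n K) (l : NilDual n K) (x : nil n K) :
    (t • l) x = l ⟨x * t, mul_mem_nil_right t.2 x.2⟩ := rfl

theorem op_smul_dual_apply (t : borel n K) (l : NilDual n K) (x : nil n K) :
    (MulOpposite.op t • l) x = l ⟨t * x, mul_mem_nil_left t.2 x.2⟩ := rfl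

instance bimodule : SMulCommClass (borel n K) (borel n K)ᵐᵒᵖ (NilDual n K) where
  smul_comm _ _ l := LinearMap.ext fun _ =>
    congrArg l (Subtype.ext (mul_assoc _ _ _).symm)

end

/-- The associative algebra `𝔤ᵃ = 𝔟 ⊕ 𝔫*` with the multiplication
`(t₁ + λ₁)(t₂ + λ₂) = t₁ t₂ + t₁ λ₂ + λ₁ t₂`. -/
abbrev ContractedAlgebra (n : ℕ) (K : Type*) [Field K] : Type _ :=
  TrivSqZeroExt (borel n K) (NilDual n K)

/-- The subspace `𝔲 = 𝔫 + 𝔫*` of `𝔤ᵃ`. -/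
def radical (n : ℕ) (K : Type*) [Field K] : Submodule K (ContractedAlgebra n K) where
  carrier := {X | (X.fst : Matrix (Fin n) (Fin n) K) ∈ nil n K}
  zero_mem' := (nil n K).zero_mem
  add_mem' := fun ha hb => (nil n K).add_mem ha hb
  smul_mem' := fun c _ hx => (nil n K).smul_mem c hx

section

variable {n : ℕ} {K : Type*} [Field K]

theorem mul_mem_radical_left (g : ContractedAlgebra n K) {X : ContractedAlgebra n K}
    (hX : X ∈ radical n K) : g * X ∈ radical n K :=
  mul_mem_nil_left g.fst.2 hX

theorem mul_mem_radical_right (g : ContractedAlgebra n K) {X : ContractedAlgebra n K}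
    (hX : X ∈ radical n K) : X * g ∈ radical n K :=
  mul_mem_nil_right g.fst.2 hX

theorem isUnit_one_add {X : ContractedAlgebra n K} (hX : X ∈ radical n K) : IsUnit (1 + X) := by
  rw [TrivSqZeroExt.isUnit_iff_isUnit_fst]
  set t : borel n K := (1 + X).fst with ht
  have hval : (t : Matrix (Fin n) (Fin n) K) = 1 + (X.fst : Matrix (Fin n) (Fin n) K) := rfl
  have hdet : (t : Matrix (Fin n) (Fin n) K).det = 1 := by
    rw [Matrix.det_of_isUpperTriangular t.2]
    refine Finset.prod_eq_one fun i _ => ?_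
    rw [hval, Matrix.add_apply, Matrix.one_apply_eq, hX i i le_rfl, add_zero]
  have hu : IsUnit (t : Matrix (Fin n) (Fin n) K).det := by rw [hdet]; exact isUnit_one
  let _ := Matrix.invertibleOfIsUnitDet _ hu
  have hinv : (t : Matrix (Fin n) (Fin n) K)⁻¹ ∈ borel n K :=
    Matrix.blockTriangular_inv_of_blockTriangular t.2
  exact ⟨⟨t, ⟨_, hinv⟩, Subtype.ext (Matrix.mul_nonsing_inv _ hu),
    Subtype.ext (Matrix.nonsing_inv_mul _ hu)⟩, rfl⟩

end

/-- The group `Uᵃ = 1 + 𝔲`, a subgroup of the group `Gᵃ` of invertible elements of `𝔤ᵃ`.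
Every `1 + X` with `X ∈ 𝔲` is invertible (`isUnit_one_add`), so that this is all of `1 + 𝔲`. -/
def Ua (n : ℕ) (K : Type*) [Field K] : Subgroup (ContractedAlgebra n K)ˣ where
  carrier := {g | (g : ContractedAlgebra n K) - 1 ∈ radical n K}
  one_mem' := by simp
  mul_mem' := fun {a b} ha hb => by
    have h : ((a * b : (ContractedAlgebra n K)ˣ) : ContractedAlgebra n K) - 1
        = a * ((b : ContractedAlgebra n K) - 1) + ((a : ContractedAlgebra n K) - 1) := by
      rw [Units.val_mul, mul_sub, mul_one, sub_add_sub_cancel]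
    change _ ∈ radical n K
    rw [h]
    exact (radical n K).add_mem (mul_mem_radical_left _ hb) ha
  inv_mem' := fun {a} ha => by
    have h : ((a⁻¹ : (ContractedAlgebra n K)ˣ) : ContractedAlgebra n K) - 1
        = -(((a⁻¹ : (ContractedAlgebra n K)ˣ) : ContractedAlgebra n K)
          * ((a : ContractedAlgebra n K) - 1)) := by
      rw [mul_sub, Units.inv_mul, mul_one, neg_sub]
    change _ ∈ radical n K
    rw [h]
    exact (radical n K).neg_mem (mul_mem_radical_left _ ha)

section

variable {n : ℕ} {K : Type*} [Field K]

/-- The underlying element of `𝔤ᵃ` of an element of `Uᵃ`. -/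
def toAlg (u : Ua n K) : ContractedAlgebra n K := u.1.1

/-- The element `1 + X` of `Uᵃ`, for `X ∈ 𝔲`. -/
noncomputable def oneAdd (X : ContractedAlgebra n K) (hX : X ∈ radical n K) : Ua n K :=
  ⟨(isUnit_one_add hX).unit, by
    change ((isUnit_one_add hX).unit : ContractedAlgebra n K) - 1 ∈ radical n K
    rw [IsUnit.unit_spec, add_sub_cancel_left]
    exact hX⟩

theorem toAlg_oneAdd (X : ContractedAlgebra n K) (hX : X ∈ radical n K) :
    toAlg (oneAdd X hX) = 1 + X := rfl

/-- The superclass `K(u) = 1 + Uᵃ X Uᵃ` of the element `u = 1 + X` of `Uᵃ`. -/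
def superclass (u : Ua n K) : Set (Ua n K) :=
  {v | ∃ a b : Ua n K, toAlg v = 1 + toAlg a * (toAlg u - 1) * toAlg b}

/-- A subset of `Uᵃ` is a superclass if it is the superclass of some element. -/
def IsSuperclass (C : Set (Ua n K)) : Prop := ∃ u : Ua n K, C = superclass u

end

/-- A root: a pair `(i, j)` with `i ≠ j`; it is positive if `i < j` and negative if `i > j`. -/
abbrev Root (n : ℕ) : Type := {α : Fin n × Fin n // α.1 ≠ α.2}

/-- The row number of a root. -/
def Root.row {n : ℕ} (α : Root n) : Fin n := α.1.1

/-- The column number of a root. -/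
def Root.col {n : ℕ} (α : Root n) : Fin n := α.1.2

/-- A rook placement: a set of roots with at most one root in any row and in any column. -/
structure RookPlacement (n : ℕ) where
  /-- The roots of the placement. -/
  roots : Finset (Root n)
  row_inj : ∀ α ∈ roots, ∀ β ∈ roots, Root.row α = Root.row β → α = β
  col_inj : ∀ α ∈ roots, ∀ β ∈ roots, Root.col α = Root.col β → α = β

section

variable {n : ℕ}

theorem single_mem_borel (K : Type*) [Field K] {i j : Fin n} (h : i < j) :
    Matrix.single i j (1 : K) ∈ borel n K :=
  Matrix.blockTriangular_single h.le 1

theorem single_mem_nil (K : Type*) [Field K] {i j : Fin n} (h : i < j) :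
    Matrix.single i j (1 : K) ∈ nil n K := by
  intro k l hkl
  refine Matrix.single_apply_of_ne _ _ _ _ _ ?_
  rintro ⟨rfl, rfl⟩
  exact absurd h hkl.not_gt

/-- The matrix unit `E_{ij} ∈ 𝔫`, for `i < j`, as an element of `𝔤ᵃ`. -/
def unitE (K : Type*) [Field K] (i j : Fin n) (h : i < j) : ContractedAlgebra n K :=
  TrivSqZeroExt.inl ⟨Matrix.single i j 1, single_mem_borel K h⟩

/-- The functional `x ↦ x_{ji}` on `𝔫`; for `i > j` it is the matrix unit of `𝔫₋ = 𝔫*`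
in position `(i, j)`, dual to `E_{ji}` under the trace form. -/
def coord (K : Type*) [Field K] (i j : Fin n) : NilDual n K where
  toFun x := (x : Matrix (Fin n) (Fin n) K) j i
  map_add' _ _ := rfl
  map_smul' _ _ := rfl

theorem coord_apply (K : Type*) [Field K] (i j : Fin n) (x : nil n K) :
    coord K i j x = (x : Matrix (Fin n) (Fin n) K) j i := rfl

/-- The matrix unit `F_{ij} ∈ 𝔫*` (used for `i > j`), as an element of `𝔤ᵃ`. -/
def unitF (K : Type*) [Field K] (i j : Fin n) : ContractedAlgebra n K :=
  TrivSqZeroExt.inr (coord K i j)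

/-- The basis vector of `𝔲` attached to a root: `E_α` if `α` is positive, `F_α` if `α` is
negative. -/
def rootVector (K : Type*) [Field K] (α : Root n) : ContractedAlgebra n K :=
  if h : α.row < α.col then unitE K α.row α.col h else unitF K α.row α.col

variable {K : Type*} [Field K]

theorem rootVector_mem (α : Root n) : rootVector K α ∈ radical n K := by
  unfold rootVector
  split_ifs with h
  · exact single_mem_nil K h
  · exact (nil n K).zero_mem

/-- The element `X_{D,φ} = ∑_{γ ∈ D₊} φ(γ) E_γ + ∑_{γ ∈ D₋} φ(γ) F_γ` of `𝔲`. -/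
def rookX (D : RookPlacement n) (φ : D.roots → Kˣ) : ContractedAlgebra n K :=
  ∑ γ : D.roots, (φ γ : K) • rootVector K γ.1

theorem rookX_mem (D : RookPlacement n) (φ : D.roots → Kˣ) : rookX D φ ∈ radical n K :=
  (radical n K).sum_mem fun γ _ => (radical n K).smul_mem _ (rootVector_mem γ.1)

/-- The element `u_{D,φ} = 1 + X_{D,φ}` of `Uᵃ`. -/
noncomputable def rookElement (D : RookPlacement n) (φ : D.roots → Kˣ) : Ua n K :=
  oneAdd (rookX D φ) (rookX_mem D φ)

end

end BorelContraction

namespace BorelContraction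

section

variable {n : ℕ} {K : Type*} [Field K]

/-! Give an element of `𝔤ᵃ` coordinates on the full `n × n` grid: matrix entries on and above the
diagonal, coefficients of the `F_{ij}` below it. Place the indices on a circle. The product becomes
the matrix product in which the term `X_{ik} Y_{kj}` survives only if `k` lies on the clockwise arc
from `i` to `j` (`entry_mul`). Elements of `Uᵃ` have diagonal coordinates 1, so superclasses are
orbits of row and column operations restricted by this arc condition, and the `X_{D,φ}` are the
monomial elements of `𝔲`.

Existence is Gaussian elimination with the shortest available arc as pivot: every other nonzero
coordinate in the pivot's row or column then has a longer or equal arc, which contains the pivot's,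
so the operation that clears it is allowed (`exists_twoSided_isIsolated`).

For uniqueness, let `X` and `Y = aXb` be monomial and compare `aX = Yb⁻¹` at a nonzero position `(i,
j)` of `X`. The left side is `X_{ij}`, so `Y` has a nonzero coordinate in row `i` at some `l` on the
arc from `i` to `j`. Exchanging `X` and `Y` gives the reverse inclusion of arcs, hence `l = j` and
equal values (`IsMonomial.entry_eq_of_twoSided`). -/

/-! ### Arcs on the circle of indices -/

/-- `k` lies on the clockwise arc from `i` to `j` in the cyclic order of `Fin n`. -/
def OnArc (i k j : Fin n) : Prop := (i ≤ k ∧ k ≤ j) ∨ (j < i ∧ (i ≤ k ∨ k ≤ j))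

instance (i k j : Fin n) : Decidable (OnArc i k j) := by
  unfold OnArc
  infer_instance

/-- The number of steps of the clockwise arc from `i` to `j`. -/
def arcLength (i j : Fin n) : ℕ := if i ≤ j then j.val - i.val else n + j.val - i.val

/-- Arcs with a common start, and likewise those with a common end, are nested according to length;
this turns minimality of a pivot into the arc condition of the product. -/
theorem onArc_of_arcLength_le_left {i k j : Fin n} (h : arcLength i k ≤ arcLength i j) :
    OnArc i k j := by
  unfold arcLength at h
  unfold OnArc
  simp only [Fin.le_def, Fin.lt_def] at *
  split_ifs at h <;> omega

theorem onArc_of_arcLength_le_right {i k j : Fin n} (h : arcLength k j ≤ arcLength i j) :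
    OnArc i k j := by
  unfold arcLength at h
  unfold OnArc
  simp only [Fin.le_def, Fin.lt_def] at *
  split_ifs at h <;> omega

theorem onArc_left (i j : Fin n) : OnArc i i j := onArc_of_arcLength_le_left (by simp [arcLength])

theorem OnArc.antisymm {i k j : Fin n} (h : OnArc i k j) (h' : OnArc i j k) : k = j := by
  unfold OnArc at h h'
  simp only [Fin.le_def, Fin.lt_def, Fin.ext_iff] at *
  omega

/-! ### Coordinates on `𝔤ᵃ` and the product in coordinates -/

/-- The matrix unit `E_{ij} ∈ 𝔫`, for `i < j`. -/
def nilUnit (K : Type*) [Field K] {i j : Fin n} (h : i < j) : nil n K :=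
  ⟨Matrix.single i j 1, single_mem_nil K h⟩

/-- The coordinate of an element of `𝔤ᵃ` at position `(i, j)`: a matrix entry on and above the
diagonal, and the coefficient of `F_{ij}` below it. -/
def entry (X : ContractedAlgebra n K) (i j : Fin n) : K :=
  if h : j < i then X.snd (nilUnit K h) else (X.fst : Matrix (Fin n) (Fin n) K) i j

theorem entry_of_lt (X : ContractedAlgebra n K) {i j : Fin n} (h : j < i) :
    entry X i j = X.snd (nilUnit K h) := dif_pos h

theorem entry_of_le (X : ContractedAlgebra n K) {i j : Fin n} (h : i ≤ j) :
    entry X i j = (X.fst : Matrix (Fin n) (Fin n) K) i j := dif_neg h.not_gt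

theorem entry_add (X Y : ContractedAlgebra n K) (i j : Fin n) :
    entry (X + Y) i j = entry X i j + entry Y i j := by
  unfold entry
  split_ifs <;> simp

theorem entry_smul (c : K) (X : ContractedAlgebra n K) (i j : Fin n) :
    entry (c • X) i j = c * entry X i j := by
  unfold entry
  split_ifs <;> simp

theorem entry_zero (i j : Fin n) : entry (0 : ContractedAlgebra n K) i j = 0 := by
  unfold entry
  split_ifs <;> simp

theorem entry_sum {ι : Type*} (s : Finset ι) (X : ι → ContractedAlgebra n K) (i j : Fin n) :
    entry (∑ a ∈ s, X a) i j = ∑ a ∈ s, entry (X a) i j := by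
  classical
  induction s using Finset.induction_on with
  | empty => simp [entry_zero]
  | insert a s ha ih => rw [Finset.sum_insert ha, Finset.sum_insert ha, entry_add, ih]

theorem nil_eq_sum (x : nil n K) :
    x = ∑ p : {p : Fin n × Fin n // p.1 < p.2},
      (x : Matrix (Fin n) (Fin n) K) p.1.1 p.1.2 • nilUnit K p.2 := by
  apply Subtype.ext
  ext i j
  rw [AddSubmonoidClass.coe_finsetSum, Matrix.sum_apply]
  by_cases h : i < j
  · rw [Finset.sum_eq_single ⟨(i, j), h⟩]
    · simp [nilUnit]
    · rintro ⟨⟨k, l⟩, hkl⟩ _ hne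
      have : ¬ (k = i ∧ l = j) := fun hh => hne (by simp [hh.1, hh.2])
      simp [nilUnit, Matrix.single_apply_of_ne _ _ _ _ _ this]
    · simp
  · rw [x.2 i j (not_lt.1 h), Finset.sum_eq_zero]
    rintro ⟨⟨k, l⟩, hkl⟩ _
    have : ¬ (k = i ∧ l = j) := by
      rintro ⟨rfl, rfl⟩
      exact h hkl
    simp [nilUnit, Matrix.single_apply_of_ne _ _ _ _ _ this]

theorem entry_ext {X Y : ContractedAlgebra n K} (h : ∀ i j, entry X i j = entry Y i j) :
    X = Y := by
  refine TrivSqZeroExt.ext (Subtype.ext ?_) (LinearMap.ext fun x => ?_)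
  · ext i j
    rcases lt_or_ge j i with hij | hij
    · rw [show (X.fst : Matrix (Fin n) (Fin n) K) i j = 0 from X.fst.2 hij,
        show (Y.fst : Matrix (Fin n) (Fin n) K) i j = 0 from Y.fst.2 hij]
    · rw [← entry_of_le X hij, ← entry_of_le Y hij, h]
  · rw [nil_eq_sum x, map_sum, map_sum]
    refine Finset.sum_congr rfl fun p _ => ?_
    rw [map_smul, map_smul, ← entry_of_lt X p.2, ← entry_of_lt Y p.2, h]

/-- The hypotheses describe `E_{ji} t` with `t` upper triangular, the argument at which the left
action is evaluated; the next lemma treats `t E_{ji}` for the right action. Summing over all `k`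
makes both fit the sum in `entry_mul`. -/
theorem dual_apply_eq_sum_of_row (l : NilDual n K) (x : nil n K) {i j : Fin n} (hij : j < i)
    (hrow : ∀ r s, r ≠ j → (x : Matrix (Fin n) (Fin n) K) r s = 0)
    (hcol : ∀ s, s < i → (x : Matrix (Fin n) (Fin n) K) j s = 0) :
    l x = ∑ k, if h : i ≤ k then
      (x : Matrix (Fin n) (Fin n) K) j k * l (nilUnit K (hij.trans_le h)) else 0 := by
  have hx : x = ∑ k, if h : i ≤ k then
      (x : Matrix (Fin n) (Fin n) K) j k • nilUnit K (hij.trans_le h) else 0 := by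
    apply Subtype.ext
    ext r s
    rw [AddSubmonoidClass.coe_finsetSum, Matrix.sum_apply, Finset.sum_eq_single s]
    · by_cases hr : r = j
      · subst hr
        split_ifs with h
        · simp [nilUnit]
        · rw [hcol s (not_le.1 h)]; simp
      · rw [hrow r s hr]
        split_ifs with h
        · simp [nilUnit, Ne.symm hr]
        · simp
    · intro k _ hk
      split_ifs with h
      · simp [nilUnit, hk]
      · simp
    · simp
  conv_lhs => rw [hx, map_sum]
  refine Finset.sum_congr rfl fun k _ => ?_
  split_ifs <;> simp

theorem dual_apply_eq_sum_of_col (l : NilDual n K) (x : nil n K) {i j : Fin n} (hij : j < i)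
    (hcol : ∀ r s, s ≠ i → (x : Matrix (Fin n) (Fin n) K) r s = 0)
    (hrow : ∀ r, j < r → (x : Matrix (Fin n) (Fin n) K) r i = 0) :
    l x = ∑ k, if h : k ≤ j then
      (x : Matrix (Fin n) (Fin n) K) k i * l (nilUnit K (h.trans_lt hij)) else 0 := by
  have hx : x = ∑ k, if h : k ≤ j then
      (x : Matrix (Fin n) (Fin n) K) k i • nilUnit K (h.trans_lt hij) else 0 := by
    apply Subtype.ext
    ext r s
    rw [AddSubmonoidClass.coe_finsetSum, Matrix.sum_apply, Finset.sum_eq_single r]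
    · by_cases hs : s = i
      · subst hs
        split_ifs with h
        · simp [nilUnit]
        · rw [hrow r (not_le.1 h)]; simp
      · rw [hcol r s hs]
        split_ifs with h
        · simp [nilUnit, Ne.symm hs]
        · simp
    · intro k _ hk
      split_ifs with h
      · simp [nilUnit, hk]
      · simp
    · simp
  conv_lhs => rw [hx, map_sum]
  refine Finset.sum_congr rfl fun k _ => ?_
  split_ifs <;> simp

/-- In coordinates the product of `𝔤ᵃ` is the matrix product with the terms dropped whose
two arcs together wrap around the circle. -/
theorem entry_mul (X Y : ContractedAlgebra n K) (i j : Fin n) :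
    entry (X * Y) i j = ∑ k, if OnArc i k j then entry X i k * entry Y k j else 0 := by
  rcases lt_or_ge j i with hij | hij
  · have hsnd : (X * Y).snd = X.fst • Y.snd + MulOpposite.op Y.fst • X.snd := rfl
    rw [entry_of_lt _ hij, hsnd, LinearMap.add_apply, smul_dual_apply, op_smul_dual_apply,
      dual_apply_eq_sum_of_row _ _ hij, dual_apply_eq_sum_of_col _ _ hij,
      ← Finset.sum_add_distrib]
    · refine Finset.sum_congr rfl fun k _ => ?_
      -- Since `j < i`, the conditions `i ≤ k` and `k ≤ j` exclude each other: the first selects a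
      -- term of the left action, the second one of the right action, and any other `k` is off the
      -- arc.
      by_cases h₁ : i ≤ k
      · have h₂ : ¬ k ≤ j := not_le.2 (hij.trans_le h₁)
        rw [dif_pos h₁, dif_neg h₂, add_zero, if_pos (show OnArc i k j from Or.inr ⟨hij, Or.inl h₁⟩),
          entry_of_le X h₁, entry_of_lt Y (hij.trans_le h₁)]
        simp [nilUnit]
      · by_cases h₂ : k ≤ j
        · rw [dif_neg h₁, dif_pos h₂, zero_add, if_pos (show OnArc i k j from Or.inr ⟨hij, Or.inr h₂⟩),
            entry_of_lt X (h₂.trans_lt hij), entry_of_le Y h₂]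
          simp [nilUnit, mul_comm]
        · rw [dif_neg h₁, dif_neg h₂, if_neg, add_zero]
          rintro (h | h)
          · exact h₁ h.1
          · exact h.2.elim h₁ h₂
    · intro r s hs
      simp [nilUnit, hs]
    · intro r hr
      simpa [nilUnit] using Y.fst.2 hr
    · intro r s hr
      simp [nilUnit, hr]
    · intro s hs
      simpa [nilUnit] using X.fst.2 hs
  · have hfst : ((X * Y).fst : Matrix (Fin n) (Fin n) K) = X.fst.1 * Y.fst.1 := rfl
    rw [entry_of_le _ hij, hfst, Matrix.mul_apply]
    refine Finset.sum_congr rfl fun k _ => ?_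
    split_ifs with h
    · rcases h with h | h
      · rw [entry_of_le _ h.1, entry_of_le _ h.2]
      · exact absurd h.1 hij.not_gt
    -- For `i ≤ j` the terms off the arc are already zero by triangularity.
    · rcases lt_or_ge k i with hk | hk
      · rw [show X.fst.1 i k = 0 from X.fst.2 hk, zero_mul]
      · have hj : j < k := not_le.1 fun hj => h (Or.inl ⟨hk, hj⟩)
        rw [show Y.fst.1 k j = 0 from Y.fst.2 hj, mul_zero]

theorem entry_one_self (i : Fin n) : entry (1 : ContractedAlgebra n K) i i = 1 := by
  rw [entry_of_le _ le_rfl]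
  exact Matrix.one_apply_eq i

theorem mem_radical_iff (X : ContractedAlgebra n K) :
    X ∈ radical n K ↔ ∀ i, entry X i i = 0 := by
  constructor
  · intro h i
    rw [entry_of_le _ le_rfl]
    exact h i i le_rfl
  · intro h i j hij
    rcases hij.lt_or_eq with hij | rfl
    · exact X.fst.2 hij
    · rw [← entry_of_le X le_rfl, h]

theorem toAlg_sub_one_mem (u : Ua n K) : toAlg u - 1 ∈ radical n K := u.2

theorem entry_toAlg_self (u : Ua n K) (i : Fin n) : entry (toAlg u) i i = 1 := by
  rw [← sub_add_cancel (toAlg u) 1, entry_add, entry_one_self,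
    (mem_radical_iff _).1 (toAlg_sub_one_mem u), zero_add]

/-- The element of `𝔤ᵃ` with prescribed coordinates. -/
def ofEntries (f : Fin n → Fin n → K) : ContractedAlgebra n K :=
  TrivSqZeroExt.inl ⟨Matrix.of fun i j => if i ≤ j then f i j else 0,
      fun i j (h : j < i) => if_neg h.not_ge⟩ +
    -- Pairs with `p.1 ≤ p.2` contribute nothing, as `coord` then reads an entry that vanishes on
    -- `𝔫`.
    TrivSqZeroExt.inr (∑ p : Fin n × Fin n, f p.1 p.2 • coord K p.1 p.2)

theorem entry_ofEntries (f : Fin n → Fin n → K) (i j : Fin n) :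
    entry (ofEntries f) i j = f i j := by
  rcases lt_or_ge j i with h | h
  · have hsnd : (ofEntries f).snd = ∑ p : Fin n × Fin n, f p.1 p.2 • coord K p.1 p.2 := by
      simp [ofEntries]
    rw [entry_of_lt _ h, hsnd, LinearMap.sum_apply, Finset.sum_eq_single (i, j)]
    · simp [coord_apply, nilUnit]
    · rintro ⟨k, l⟩ _ hne
      have : ¬ (j = l ∧ i = k) := fun hh => hne (by simp [hh.1, hh.2])
      simp [coord_apply, nilUnit, Matrix.single_apply_of_ne _ _ _ _ _ this]
    · simp
  · rw [entry_of_le _ h]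
    simp [ofEntries, h]

/-! ### Monomial elements and rook placements -/

theorem entry_rootVector (α : Root n) (i j : Fin n) :
    entry (rootVector K α) i j = if α.row = i ∧ α.col = j then 1 else 0 := by
  unfold rootVector
  split_ifs with h h' h'
  · obtain ⟨rfl, rfl⟩ := h'
    rw [entry_of_le _ h.le]
    simp [unitE]
  · rcases lt_or_ge j i with hij | hij
    · simp [entry_of_lt _ hij, unitE]
    · rw [entry_of_le _ hij]
      exact Matrix.single_apply_of_ne _ _ _ _ _ h'
  · obtain ⟨rfl, rfl⟩ := h'
    have hlt : α.col < α.row := lt_of_le_of_ne (not_lt.1 h) (Ne.symm α.2)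
    simp [entry_of_lt _ hlt, unitF, coord_apply, nilUnit]
  · rcases lt_or_ge j i with hij | hij
    · have h'' : ¬ (j = α.col ∧ i = α.row) := fun hh => h' ⟨hh.2.symm, hh.1.symm⟩
      simp [entry_of_lt _ hij, unitF, coord_apply, nilUnit,
        Matrix.single_apply_of_ne _ _ _ _ _ h'']
    · simp [entry_of_le _ hij, unitF]

theorem entry_rookX (D : RookPlacement n) (φ : D.roots → Kˣ) (i j : Fin n) :
    entry (rookX D φ) i j =
      ∑ γ : D.roots, if γ.1.row = i ∧ γ.1.col = j then (φ γ : K) else 0 := by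
  rw [rookX, entry_sum]
  refine Finset.sum_congr rfl fun γ _ => ?_
  rw [entry_smul, entry_rootVector, mul_ite, mul_one, mul_zero]

theorem entry_rookX_root (D : RookPlacement n) (φ : D.roots → Kˣ) (γ : D.roots) :
    entry (rookX D φ) γ.1.row γ.1.col = φ γ := by
  rw [entry_rookX, Finset.sum_eq_single γ, if_pos ⟨rfl, rfl⟩]
  · intro β _ hβ
    exact if_neg fun h => hβ (Subtype.ext (D.row_inj _ β.2 _ γ.2 h.1))
  · simp

theorem exists_root_of_entry_rookX_ne_zero {D : RookPlacement n} {φ : D.roots → Kˣ}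
    {i j : Fin n} (h : entry (rookX D φ) i j ≠ 0) :
    ∃ γ : D.roots, γ.1.row = i ∧ γ.1.col = j := by
  rw [entry_rookX] at h
  obtain ⟨γ, _, hγ⟩ := Finset.exists_ne_zero_of_sum_ne_zero h
  exact ⟨γ, by_contra fun hne => hγ (if_neg hne)⟩

/-- The coordinates of `X` have at most one nonzero value in every row and every column. -/
def IsMonomial (X : ContractedAlgebra n K) : Prop :=
  ∀ i j, entry X i j ≠ 0 →
    (∀ l, l ≠ j → entry X i l = 0) ∧ ∀ k, k ≠ i → entry X k j = 0

theorem isMonomial_rookX (D : RookPlacement n) (φ : D.roots → Kˣ) :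
    IsMonomial (rookX D φ) := by
  intro i j h
  obtain ⟨γ, rfl, rfl⟩ := exists_root_of_entry_rookX_ne_zero h
  refine ⟨fun l hl => by_contra fun hne => ?_, fun k hk => by_contra fun hne => ?_⟩
  · obtain ⟨β, hr, rfl⟩ := exists_root_of_entry_rookX_ne_zero hne
    exact hl (by rw [D.row_inj _ β.2 _ γ.2 hr])
  · obtain ⟨β, rfl, hc⟩ := exists_root_of_entry_rookX_ne_zero hne
    exact hk (by rw [D.col_inj _ β.2 _ γ.2 hc])

/-- The support of `X` is the placement and its values are `φ`; membership in `𝔲` keeps the support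
off the diagonal, so that it consists of roots. -/
theorem IsMonomial.exists_eq_rookX {X : ContractedAlgebra n K} (hX : X ∈ radical n K)
    (hm : IsMonomial X) : ∃ (D : RookPlacement n) (φ : D.roots → Kˣ), X = rookX D φ := by
  classical
  let S : Finset (Root n) := Finset.univ.filter fun α => entry X α.row α.col ≠ 0
  have hS : ∀ α ∈ S, entry X α.row α.col ≠ 0 := fun α hα => (Finset.mem_filter.1 hα).2
  let D : RookPlacement n :=
    { roots := S
      row_inj := fun α hα β hβ h => by
        by_contra hne
        refine hS β hβ ?_
        rw [← h]
        exact (hm _ _ (hS α hα)).1 _ fun hc => hne (Subtype.ext (Prod.ext h hc.symm))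
      col_inj := fun α hα β hβ h => by
        by_contra hne
        refine hS β hβ ?_
        rw [← h]
        exact (hm _ _ (hS α hα)).2 _ fun hr => hne (Subtype.ext (Prod.ext hr.symm h)) }
  refine ⟨D, fun γ => Units.mk0 _ (hS γ.1 γ.2), entry_ext fun i j => ?_⟩
  by_cases h : entry X i j = 0
  · rw [h]
    by_contra hne
    obtain ⟨γ, rfl, rfl⟩ := exists_root_of_entry_rookX_ne_zero (Ne.symm hne)
    exact hS γ.1 γ.2 h
  · have hij : i ≠ j := by
      rintro rfl
      exact h ((mem_radical_iff X).1 hX i)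
    have hmem : (⟨(i, j), hij⟩ : Root n) ∈ D.roots := Finset.mem_filter.2 ⟨Finset.mem_univ _, h⟩
    exact (entry_rookX_root D (fun γ => Units.mk0 _ (hS γ.1 γ.2)) ⟨_, hmem⟩).symm

/-! ### Double cosets of `Uᵃ` -/

/-- `Y` lies in the double coset `Uᵃ X Uᵃ`. -/
def TwoSided (X Y : ContractedAlgebra n K) : Prop :=
  ∃ a b : Ua n K, Y = toAlg a * X * toAlg b

theorem toAlg_mul (a b : Ua n K) : toAlg (a * b) = toAlg a * toAlg b := rfl

theorem toAlg_one : toAlg (1 : Ua n K) = 1 := rfl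

theorem toAlg_inv_mul (a : Ua n K) : toAlg a⁻¹ * toAlg a = 1 := by
  rw [← toAlg_mul, inv_mul_cancel, toAlg_one]

theorem toAlg_mul_inv (a : Ua n K) : toAlg a * toAlg a⁻¹ = 1 := by
  rw [← toAlg_mul, mul_inv_cancel, toAlg_one]

theorem TwoSided.refl (X : ContractedAlgebra n K) : TwoSided X X :=
  ⟨1, 1, by rw [toAlg_one, one_mul, mul_one]⟩

theorem TwoSided.symm {X Y : ContractedAlgebra n K} (h : TwoSided X Y) : TwoSided Y X := by
  obtain ⟨a, b, rfl⟩ := h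
  refine ⟨a⁻¹, b⁻¹, ?_⟩
  rw [mul_assoc, mul_assoc, toAlg_mul_inv, mul_one, ← mul_assoc, toAlg_inv_mul, one_mul]

theorem TwoSided.trans {X Y Z : ContractedAlgebra n K} (h : TwoSided X Y) (h' : TwoSided Y Z) :
    TwoSided X Z := by
  obtain ⟨a, b, rfl⟩ := h
  obtain ⟨c, d, rfl⟩ := h'
  exact ⟨c * a, b * d, by simp only [toAlg_mul, mul_assoc]⟩

theorem TwoSided.mem_radical {X Y : ContractedAlgebra n K} (h : TwoSided X Y)
    (hX : X ∈ radical n K) : Y ∈ radical n K := by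
  obtain ⟨a, b, rfl⟩ := h
  exact mul_mem_radical_right _ (mul_mem_radical_left _ hX)

theorem rookElement_mem_superclass_iff (D : RookPlacement n) (φ : D.roots → Kˣ) (u : Ua n K) :
    rookElement D φ ∈ superclass u ↔ TwoSided (toAlg u - 1) (rookX D φ) :=
  exists₂_congr fun _ _ => add_right_inj (1 : ContractedAlgebra n K)

/-! ### Uniqueness -/

/-- For a nonzero coordinate of a monomial `X`, any monomial in its double coset has a nonzero
coordinate in the same row, at an arc which is not longer, with the same value if the arc is the
same. -/
theorem IsMonomial.exists_onArc_of_twoSided {X Y : ContractedAlgebra n K} (hX : IsMonomial X)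
    (hY : IsMonomial Y) (h : TwoSided X Y) {i j : Fin n} (hij : entry X i j ≠ 0) :
    ∃ l, OnArc i l j ∧ entry Y i l ≠ 0 ∧ (l = j → entry Y i j = entry X i j) := by
  obtain ⟨a, b, hab⟩ := h
  have key : toAlg a * X = Y * toAlg b⁻¹ := by
    rw [hab, mul_assoc, toAlg_mul_inv, mul_one]
  -- Column `j` of `X` has only the coordinate at `(i, j)`, and `a` has diagonal 1.
  have hl : entry (toAlg a * X) i j = entry X i j := by
    rw [entry_mul, Finset.sum_eq_single i, if_pos (onArc_left i j), entry_toAlg_self, one_mul]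
    · intro k _ hk
      rw [(hX i j hij).2 k hk, mul_zero, ite_self]
    · simp
  have hne : entry (Y * toAlg b⁻¹) i j ≠ 0 := by rwa [← key, hl]
  rw [entry_mul] at hne
  obtain ⟨l, -, hl'⟩ := Finset.exists_ne_zero_of_sum_ne_zero hne
  have harc : OnArc i l j := by_contra fun hn => hl' (if_neg hn)
  rw [if_pos harc] at hl'
  refine ⟨l, harc, left_ne_zero_of_mul hl', ?_⟩
  rintro rfl
  -- Row `i` of `Y` has only the coordinate at `l = j`, and `b⁻¹` has diagonal 1.
  rw [← hl, key, entry_mul, Finset.sum_eq_single l, if_pos harc, entry_toAlg_self, mul_one]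
  · intro k _ hk
    rw [(hY i l (left_ne_zero_of_mul hl')).1 k hk, zero_mul, ite_self]
  · simp

theorem IsMonomial.entry_eq_of_twoSided {X Y : ContractedAlgebra n K} (hX : IsMonomial X)
    (hY : IsMonomial Y) (h : TwoSided X Y) {i j : Fin n} (hij : entry X i j ≠ 0) :
    entry Y i j = entry X i j := by
  obtain ⟨l, hl, hne, heq⟩ := hX.exists_onArc_of_twoSided hY h hij
  obtain ⟨m, hm, hne', -⟩ := hY.exists_onArc_of_twoSided hX h.symm hne
  -- Row `i` of `X` is nonzero only at `j`, so each of `l`, `j` lies on the arc from `i` to the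
  -- other.
  have hmj : m = j := by_contra fun hmj => hne' ((hX i j hij).1 m hmj)
  subst hmj
  exact heq (hl.antisymm hm)

theorem IsMonomial.eq_of_twoSided {X Y : ContractedAlgebra n K} (hX : IsMonomial X)
    (hY : IsMonomial Y) (h : TwoSided X Y) : X = Y := by
  refine entry_ext fun i j => ?_
  by_cases hij : entry X i j = 0
  · by_contra hne
    rw [hij] at hne
    exact hne (hij.symm.trans (hY.entry_eq_of_twoSided hX h.symm (Ne.symm hne)))
  · exact (hX.entry_eq_of_twoSided hY h hij).symm

theorem rookX_injective {D D' : RookPlacement n} {φ : D.roots → Kˣ} {φ' : D'.roots → Kˣ}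
    (h : rookX D φ = rookX D' φ') :
    (⟨D, φ⟩ : (E : RookPlacement n) × (E.roots → Kˣ)) = ⟨D', φ'⟩ := by
  have hsub : ∀ {D D' : RookPlacement n} {φ : D.roots → Kˣ} {φ' : D'.roots → Kˣ},
      rookX D φ = rookX D' φ' → D.roots ⊆ D'.roots := by
    intro D D' φ φ' h γ hγ
    have hne : entry (rookX D' φ') γ.row γ.col ≠ 0 := by
      rw [← h, entry_rookX_root D φ ⟨γ, hγ⟩]
      exact Units.ne_zero _
    obtain ⟨β, hr, hc⟩ := exists_root_of_entry_rookX_ne_zero hne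
    have : β.1 = γ := Subtype.ext (Prod.ext hr hc)
    exact this ▸ β.2
  have hD : D = D' := by
    have hr := Finset.Subset.antisymm (hsub h) (hsub h.symm)
    cases D
    cases D'
    cases hr
    rfl
  subst hD
  congr 1
  funext γ
  apply Units.ext
  rw [← entry_rookX_root D φ γ, ← entry_rookX_root D φ' γ, h]

/-! ### Existence by elimination -/

/-- The coordinate at `(i, j)` is the only nonzero one in its row and in its column. -/
def IsIsolated (X : ContractedAlgebra n K) (i j : Fin n) : Prop :=
  entry X i j ≠ 0 ∧ (∀ l, l ≠ j → entry X i l = 0) ∧ ∀ k, k ≠ i → entry X k j = 0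

/-- Right multiplication by `1 + Z`, with `Z` supported in row `j`, adds multiples of column `j` to
the other columns; `hrow` says that these additions take effect wherever row `i` has to be cleared.
The last three conclusions serve to protect isolated coordinates and column `j`. -/
theorem exists_twoSided_clear_row (X : ContractedAlgebra n K) {i j : Fin n}
    (hij : entry X i j ≠ 0) (hrow : ∀ l, l ≠ j → entry X i l ≠ 0 → OnArc i j l) :
    ∃ Y, TwoSided X Y ∧ (∀ l, l ≠ j → entry Y i l = 0) ∧
      (∀ k, entry Y k j = entry X k j) ∧
      (∀ k l, entry X k j = 0 → entry Y k l = entry X k l) ∧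
      (∀ k l, entry X i l = 0 → entry Y k l = entry X k l) := by
  let Z : ContractedAlgebra n K :=
    ofEntries fun k l => if k = j ∧ l ≠ j then -(entry X i l / entry X i j) else 0
  have hZ : Z ∈ radical n K := by
    rw [mem_radical_iff]
    intro k
    rw [entry_ofEntries]
    exact if_neg fun h => h.2 h.1
  have hY : ∀ k l, entry (X * (1 + Z)) k l = entry X k l +
      if OnArc k j l then entry X k j * entry Z j l else 0 := by
    intro k l
    rw [mul_add, mul_one, entry_add, entry_mul X Z, Finset.sum_eq_single j]
    · intro m _ hm
      rw [show entry Z m l = 0 from (entry_ofEntries _ _ _).trans (if_neg fun h => hm h.1),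
        mul_zero, ite_self]
    · simp
  refine ⟨X * (1 + Z), ⟨1, oneAdd Z hZ, by rw [toAlg_one, one_mul, toAlg_oneAdd]⟩,
    fun l hl => ?_, fun k => ?_, fun k l h => ?_, fun k l h => ?_⟩
  · rw [hY]
    by_cases h : entry X i l = 0
    · rw [entry_ofEntries, h]
      simp
    · rw [if_pos (hrow l hl h), entry_ofEntries, if_pos ⟨rfl, hl⟩]
      field_simp
      ring
  · rw [hY, entry_ofEntries]
    simp
  · rw [hY, h]
    simp
  · rw [hY, entry_ofEntries, h]
    simp

/-- Multiples of row `i` are added to the other rows. As row `i` is already clear outside column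
`j`, only column `j` changes. -/
theorem exists_twoSided_clear_col (X : ContractedAlgebra n K) {i j : Fin n}
    (hij : entry X i j ≠ 0) (hcol : ∀ k, k ≠ i → entry X k j ≠ 0 → OnArc k i j)
    (hrow : ∀ l, l ≠ j → entry X i l = 0) :
    ∃ Y, TwoSided X Y ∧ (∀ k, k ≠ i → entry Y k j = 0) ∧
      (∀ k l, l ≠ j → entry Y k l = entry X k l) ∧ entry Y i j = entry X i j := by
  let Z : ContractedAlgebra n K :=
    ofEntries fun k l => if l = i ∧ k ≠ i then -(entry X k j / entry X i j) else 0
  have hZ : Z ∈ radical n K := by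
    rw [mem_radical_iff]
    intro k
    rw [entry_ofEntries]
    exact if_neg fun h => h.2 h.1
  have hY : ∀ k l, entry ((1 + Z) * X) k l = entry X k l +
      if OnArc k i l then entry Z k i * entry X i l else 0 := by
    intro k l
    rw [add_mul, one_mul, entry_add, entry_mul Z X, Finset.sum_eq_single i]
    · intro m _ hm
      rw [show entry Z k m = 0 from (entry_ofEntries _ _ _).trans (if_neg fun h => hm h.1),
        zero_mul, ite_self]
    · simp
  refine ⟨(1 + Z) * X, ⟨oneAdd Z hZ, 1, by rw [toAlg_one, mul_one, toAlg_oneAdd]⟩,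
    fun k hk => ?_, fun k l h => ?_, ?_⟩
  · rw [hY]
    by_cases h : entry X k j = 0
    · rw [entry_ofEntries, h]
      simp
    · rw [if_pos (hcol k hk h), entry_ofEntries, if_pos ⟨rfl, hk⟩]
      field_simp
      ring
  · rw [hY, hrow l h]
    simp
  · rw [hY, entry_ofEntries]
    simp

/-- A nonzero coordinate that is not isolated, of minimal arc length among these, can be made
isolated without spoiling the isolated coordinates. -/
theorem exists_twoSided_isIsolated (X : ContractedAlgebra n K) {i j : Fin n}
    (hij : entry X i j ≠ 0) (hni : ¬ IsIsolated X i j)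
    (hmin : ∀ k l, entry X k l ≠ 0 → ¬ IsIsolated X k l → arcLength i j ≤ arcLength k l) :
    ∃ Y, TwoSided X Y ∧ IsIsolated Y i j ∧ ∀ k l, IsIsolated X k l → IsIsolated Y k l := by
  -- Another nonzero coordinate in row `i` cannot be isolated, so minimality applies to it.
  obtain ⟨Y, hXY, hYrow, hYcol, hYk, hYl⟩ := exists_twoSided_clear_row X hij fun l hl h =>
    onArc_of_arcLength_le_left (hmin i l h fun hi => hij (hi.2.1 j hl.symm))
  have hYij : entry Y i j ≠ 0 := by rwa [hYcol]
  -- Column `j` is the same in `Y` as in `X`, so minimality in `X` still applies.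
  obtain ⟨W, hYW, hWcol, hWl, hWij⟩ := exists_twoSided_clear_col Y hYij (fun k hk h =>
    onArc_of_arcLength_le_right (hmin k j (by rwa [← hYcol]) fun hi => hij (hi.2.2 i hk.symm)))
    hYrow
  refine ⟨W, hXY.trans hYW, ⟨by rwa [hWij], fun l hl => by rw [hWl i l hl, hYrow l hl], hWcol⟩,
    fun k l hkl => ?_⟩
  -- An isolated `(k, l)` shares neither row nor column with `(i, j)`, so `X` vanishes at `(k, j)`
  -- and `(i, l)` and both operations leave row `k` outside column `j`, and column `l`, unchanged.
  have hki : k ≠ i := by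
    rintro rfl
    by_cases h : j = l
    · exact hni (h ▸ hkl)
    · exact hij (hkl.2.1 j h)
  have hlj : l ≠ j := by
    rintro rfl
    exact hij (hkl.2.2 i hki.symm)
  have hkj : entry X k j = 0 := hkl.2.1 j hlj.symm
  have hil : entry X i l = 0 := hkl.2.2 i hki.symm
  refine ⟨by rw [hWl k l hlj, hYk k l hkj]; exact hkl.1, fun m hm => ?_, fun m hm => ?_⟩
  · by_cases h : m = j
    · rw [h, hWcol k hki]
    · rw [hWl k m h, hYk k m hkj, hkl.2.1 m hm]
  · rw [hWl m l hlj, hYl m l hil, hkl.2.2 m hm]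

/-- An element of the double coset with the most isolated positions is monomial, since otherwise one
more could be isolated. -/
theorem exists_twoSided_isMonomial (X : ContractedAlgebra n K) :
    ∃ Y, TwoSided X Y ∧ IsMonomial Y := by
  classical
  -- Zero coordinates count as bad too, so new nonzero coordinates created by an elimination step do
  -- not raise the count.
  let bad (Y : ContractedAlgebra n K) : Finset (Fin n × Fin n) :=
    Finset.univ.filter fun p => ¬ IsIsolated Y p.1 p.2
  obtain ⟨Y, hXY, hY⟩ : ∃ Y, TwoSided X Y ∧
      ∀ W, TwoSided X W → (bad Y).card ≤ (bad W).card := by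
    obtain ⟨Y, hY, hmin⟩ := (measure fun Y => (bad Y).card).wf.has_min {Y | TwoSided X Y}
      ⟨X, TwoSided.refl X⟩
    exact ⟨Y, hY, fun W hW => not_lt.1 (hmin W hW)⟩
  refine ⟨Y, hXY, ?_⟩
  by_contra hm
  let S : Finset (Fin n × Fin n) :=
    Finset.univ.filter fun p => entry Y p.1 p.2 ≠ 0 ∧ ¬ IsIsolated Y p.1 p.2
  have hS : S.Nonempty := by
    by_contra hS
    refine hm fun i j hij => by_contra fun h => hS ⟨(i, j), ?_⟩
    exact Finset.mem_filter.2 ⟨Finset.mem_univ _, hij, fun hi => h hi.2⟩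
  obtain ⟨⟨i, j⟩, hp, hmin⟩ := S.exists_min_image (fun p => arcLength p.1 p.2) hS
  obtain ⟨-, hij, hni⟩ := Finset.mem_filter.1 hp
  obtain ⟨W, hYW, hWij, hW⟩ := exists_twoSided_isIsolated Y hij hni fun k l h h' =>
    hmin (k, l) (Finset.mem_filter.2 ⟨Finset.mem_univ _, h, h'⟩)
  refine (hY W (hXY.trans hYW)).not_gt (Finset.card_lt_card ?_)
  refine Finset.ssubset_iff_of_subset (fun p hp => ?_) |>.2 ⟨(i, j), ?_, ?_⟩
  · exact Finset.mem_filter.2 ⟨Finset.mem_univ _, fun h => (Finset.mem_filter.1 hp).2 (hW _ _ h)⟩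
  · exact Finset.mem_filter.2 ⟨Finset.mem_univ _, hni⟩
  · exact fun h => (Finset.mem_filter.1 h).2 hWij

end

end BorelContraction

open BorelContraction in
theorem theorem3p4 (n : ℕ) (K : Type*) [Field K] [Finite K] (hK : ringChar K ≠ 2) :
    (∀ C : Set (BorelContraction.Ua n K), BorelContraction.IsSuperclass C →
      ∃ (D : BorelContraction.RookPlacement n) (φ : D.roots → Kˣ),
        BorelContraction.rookElement D φ ∈ C) ∧
    (∀ (D : BorelContraction.RookPlacement n) (φ : D.roots → Kˣ)
      (D' : BorelContraction.RookPlacement n) (φ' : D'.roots → Kˣ),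
      (∃ C : Set (BorelContraction.Ua n K), BorelContraction.IsSuperclass C ∧
        BorelContraction.rookElement D φ ∈ C ∧ BorelContraction.rookElement D' φ' ∈ C) ↔
      (⟨D, φ⟩ : (E : BorelContraction.RookPlacement n) × (E.roots → Kˣ)) = ⟨D', φ'⟩) := by
  refine ⟨?_, fun D φ D' φ' => ⟨?_, fun h => ?_⟩⟩
  · rintro C ⟨u, rfl⟩
    obtain ⟨Y, hY, hm⟩ := exists_twoSided_isMonomial (toAlg u - 1)
    obtain ⟨D, φ, rfl⟩ := hm.exists_eq_rookX (hY.mem_radical (toAlg_sub_one_mem u))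
    exact ⟨D, φ, (rookElement_mem_superclass_iff D φ u).2 hY⟩
  · rintro ⟨C, ⟨u, rfl⟩, h, h'⟩
    rw [rookElement_mem_superclass_iff] at h h'
    exact rookX_injective ((isMonomial_rookX D φ).eq_of_twoSided (isMonomial_rookX D' φ')
      (h.symm.trans h'))
  · have hmem : rookElement D φ ∈ superclass (rookElement D φ) := by
      rw [rookElement_mem_superclass_iff, rookElement, toAlg_oneAdd, add_sub_cancel_left]
      exact TwoSided.refl _
    cases h
    exact ⟨_, ⟨_, rfl⟩, hmem, hmem⟩
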